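/- Let $a_0,a_1,a_2\in\mathbb C\setminus\{0\}$ (indices modulo $3$), and suppose that $q:=a_0a_1a_2$ is not a root of unity. The fourth $q$-Painlevé equation $q\mathrm{P}_{\mathrm{IV}}$ with parameters $a_0,a_1,a_2$ is the system $$f_j(qc)=a_ja_{j+1}f_{j+1}(c)\,\frac{1+a_{j+2}f_{j+2}(c)+a_{j+2}a_{j}f_{j+2}(c)f_{j}(c)}{1+a_jf_j(c)+a_ja_{j+1}f_j(c)f_{j+1}(c)}\quad(j=0,1,2),\qquad f_0f_1f_2=qc^2 ,$$ where for a solution all denominators are required to be non-zero. For $b\in\mathbb C\setminus\{0\}$, continuous $q$-Hermite–Weber functions with parameter $b$ are functions $G_\nu(c)$ satisfying the linear contiguity relations $$G_{\nu+1}(qc)=G_\nu(qc)+b^2q^{2\nu}c^2G_\nu(c),\qquad G_{\nu+1}(c)=G_\nu(qc)+c^2G_\nu(c).$$ Theorem. Suppose that $a_i=q^k$ for some $i\in\{0,1,2\}$ and some $k\in\mathbb Z$. Then there are an integer $m$ and rational functions $R_j=P_j/Q_j$ $(j=0,1,2)$ of three variables over $\mathbb C$, with $P_j,Q_j$ polynomials,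 such that the following holds. (1) Let $D\subset\mathbb C\setminus\{0\}$ satisfy $qD\subset D$, let $(G_\nu)_{\nu\ge m}$ satisfy the contiguity relations with parameter $b=a_{i+1}$ for all $\nu\ge m$ and all $c\in D$, and suppose that $Q_j(c,G_m(c),G_m(qc))\ne0$ for all $c\in D$ and $j=0,1,2$. Then $$f_j(c)=R_j\bigl(c,G_m(c),G_m(qc)\bigr)\qquad(j=0,1,2)$$ is a solution of $q\mathrm{P}_{\mathrm{IV}}$ on $D$ with parameters $a_0,a_1,a_2$. (2) These solutions form a one-parameter family: for all $c_0\in\mathbb C\setminus\{0\}$ outside a countable set, there is a countable set $E\subset\mathbb C$ such that for every $t\in\mathbb C\setminus E$ there are functions $G_\nu=G_\nu^{(t)}$ on the orbit $q^{\mathbb Z}c_0$ which satisfy the contiguity relations with parameter $a_{i+1}$ for all $\nu\ge m$ (and for all $\nu\in\mathbb Z$ if $a_{i+1}^2\notin q^{2\mathbb Z}$) and the initial condition $G_m(c_0)=1$, $G_m(qc_0)=t$, and for which the denominators $Q_j(c,G_m(c),G_m(qc))$ do not vanish on the orbit, so that $f_j=f_j^{(t)}$ as in (1) is a solution of $q\mathrm{P}_{\mathrm{IV}}$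 on $q^{\mathbb Z}c_0$. Different values $t\in\mathbb C\setminus E$ give different triples $(f_0^{(t)}(c_0),f_1^{(t)}(c_0),f_2^{(t)}(c_0))$. -/

import Mathlib

/-- The constant `q = a₀ a₁ a₂`. -/
def qConst (a : Fin 3 → ℂ) : ℂ := a 0 * a 1 * a 2

/-- `1 + a_j f_j + a_j a_{j+1} f_j f_{j+1}`, indices modulo `3`. -/
def qP4Den (a x : Fin 3 → ℂ) (j : Fin 3) : ℂ :=
  1 + a j * x j + a j * a (j + 1) * x j * x (j + 1)

/-- `f = (f₀, f₁, f₂)` solves the `q`-Painlevé IV equation with parameters `a` on `D`: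
at each `c ∈ D` one has `f₀ f₁ f₂ = q c²`, no denominator of the system vanishes, and
`f_j(qc)` is given by the time evolution applied to `f(c)`. -/
def IsQP4Solution (a : Fin 3 → ℂ) (D : Set ℂ) (f : Fin 3 → ℂ → ℂ) : Prop :=
  ∀ c ∈ D,
    f 0 c * f 1 c * f 2 c = qConst a * c ^ 2 ∧
    ∀ j : Fin 3,
      qP4Den a (fun l => f l c) j ≠ 0 ∧
      f j (qConst a * c) =
        a j * a (j + 1) * f (j + 1) c *
          (qP4Den a (fun l => f l c) (j + 2) / qP4Den a (fun l => f l c) j)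

/-- The two linear contiguity relations of the continuous `q`-Hermite–Weber functions
`G_ν(c)` with parameter `b`, for the indices `ν ∈ V` and at the points `c ∈ D`. -/
def IsQHermiteWeber (q b : ℂ) (V : Set ℤ) (D : Set ℂ) (G : ℤ → ℂ → ℂ) : Prop :=
  ∀ ν ∈ V, ∀ c ∈ D,
    G (ν + 1) (q * c) = G ν (q * c) + b ^ 2 * q ^ (2 * ν) * c ^ 2 * G ν c ∧
    G (ν + 1) c = G ν (q * c) + c ^ 2 * G ν c

/-- The `q`-orbit `{qⁿ c₀ : n ∈ ℤ}`. -/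
def qOrbit (q c₀ : ℂ) : Set ℂ := {c | ∃ n : ℤ, c = q ^ n * c₀}

/-- The value of a polynomial in three variables at `(c, g(c), g(qc))`. -/
noncomputable def evalAt (q : ℂ) (P : MvPolynomial (Fin 3) ℂ) (g : ℂ → ℂ) (c : ℂ) : ℂ :=
  MvPolynomial.eval ![c, g c, g (q * c)] P

/-- The functions `c ↦ P_j(c, g(c), g(qc)) / Q_j(c, g(c), g(qc))`, `j = 0, 1, 2`. -/
noncomputable def ratExpr (q : ℂ) (P Q : Fin 3 → MvPolynomial (Fin 3) ℂ) (g : ℂ → ℂ) :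
    Fin 3 → ℂ → ℂ :=
  fun j c => evalAt q (P j) g c / evalAt q (Q j) g c

/-! Eliminating $G_1$ from the contiguity relations at $\nu=0$ gives a linear second order equation
for $G_0$, so $h(c)=G_0(qc)/G_0(c)$ satisfies the Riccati equation $h(qc)=1-q^2c^2+b^2c^2/h(c)$. For
$a_0=1$, $b=a_1$, the triple $(-1,\,a_1c^2/h,\,-a_2h)$ solves the system (`hasRiccatiFamily_seed`).
Every other case comes from this seed by Bäcklund transformations. The reflection $s_0$ and the
index rotation compose to the translation $(a_0,a_1,a_2)\mapsto(qa_0,a_1,a_2/q)$ and its inverse.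
Since $a_1$ is fixed, the same $h$ serves all $k$. The delicate point is `HasRiccatiFamily.reflect`:
the factors by which $s_0$ multiplies and divides must not vanish identically on the family. The
family is parametrized injectively by $h$, a property that $s_0$ preserves. Along an orbit, the
Casoratian makes $h$ an injective function of the initial value $t$, so a nonzero polynomial in
$(c,h)$ vanishes somewhere on the orbit for only countably many $t$ (`exists_countable_generic`).
Homogenizing in $h=y/x$ then yields $P_j$ and $Q_j$. -/

open Polynomial

/-! ### The linear equation on an orbit: existence, genericity, contiguity -/

/-- A two-sided sequence is determined by its value at `0` and by an upward and a downward step. -/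
theorem exists_int_seq {X : Type*} (x₀ : X) (up down : ℤ → X → X) :
    ∃ v : ℤ → X, v 0 = x₀ ∧ (∀ n, 0 ≤ n → v (n + 1) = up n (v n)) ∧
      (∀ n, n < 0 → v n = down n (v (n + 1))) := by
  let vp : ℕ → X := fun n => Nat.rec x₀ (fun k x => up k x) n
  let vm : ℕ → X := fun n => Nat.rec x₀ (fun k x => down (Int.negSucc k) x) n
  refine ⟨fun n => match n with
    | Int.ofNat k => vp k
    | Int.negSucc k => vm (k + 1), rfl, ?_, ?_⟩
  · intro n hn
    obtain ⟨k, rfl⟩ := Int.eq_ofNat_of_zero_le hn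
    rfl
  · intro n hn
    obtain ⟨k, rfl⟩ := Int.eq_negSucc_of_lt_zero hn
    cases k with
    | zero => rfl
    | succ k => rfl

theorem zpow_orbit_succ {q : ℂ} (hq0 : q ≠ 0) (c₀ : ℂ) (n : ℤ) :
    q ^ (n + 1) * c₀ = q * (q ^ n * c₀) := by
  rw [zpow_add_one₀ hq0]; ring

theorem zpow_orbit_injective {q : ℂ} (hq0 : q ≠ 0) (hq : ∀ n : ℕ, 0 < n → q ^ n ≠ 1)
    {c₀ : ℂ} (hc : c₀ ≠ 0) : Function.Injective fun n : ℤ => q ^ n * c₀ := by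
  have key : ∀ n : ℤ, 0 < n → q ^ n ≠ 1 := by
    intro n hn h
    lift n to ℕ using hn.le
    exact hq n (by exact_mod_cast hn) (by simpa using h)
  have key' : ∀ m n : ℤ, m < n → q ^ m ≠ q ^ n := by
    intro m n hmn h
    apply key (n - m) (by lia)
    rw [zpow_sub₀ hq0, h, div_self (zpow_ne_zero _ hq0)]
  intro m n h
  have h' : q ^ m = q ^ n := mul_right_cancel₀ hc h
  rcases lt_trichotomy m n with hl | hl | hl
  · exact absurd h' (key' _ _ hl)
  · exact hl
  · exact absurd h'.symm (key' _ _ hl)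

/-- The sequence `n ↦ u n` satisfies the second order `q`-difference equation of the continuous
`q`-Hermite–Weber functions along the orbit `qⁿ c₀`. -/
def IsOrbitSeq (q b c₀ : ℂ) (u : ℤ → ℂ) : Prop :=
  ∀ n : ℤ, u (n + 2) =
    (1 - q ^ 2 * (q ^ n * c₀) ^ 2) * u (n + 1) + b ^ 2 * (q ^ n * c₀) ^ 2 * u n

theorem exists_isOrbitSeq {q b c₀ : ℂ} (hq0 : q ≠ 0) (hb : b ≠ 0) (hc : c₀ ≠ 0) (t : ℂ) :
    ∃ u : ℤ → ℂ, u 0 = 1 ∧ u 1 = t ∧ IsOrbitSeq q b c₀ u := by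
  -- The state is the pair $(u_n,u_{n+1})$; the downward step solves the recurrence for $u_n$,
  -- dividing by $b^2c^2$.
  obtain ⟨v, h0, hup, hdown⟩ := exists_int_seq ((1 : ℂ), t)
    (fun n x => (x.2, (1 - q ^ 2 * (q ^ n * c₀) ^ 2) * x.2 + b ^ 2 * (q ^ n * c₀) ^ 2 * x.1))
    (fun n x => ((x.2 - (1 - q ^ 2 * (q ^ n * c₀) ^ 2) * x.1) / (b ^ 2 * (q ^ n * c₀) ^ 2), x.1))
  have key : ∀ n, (v (n + 1)).1 = (v n).2 ∧ (v (n + 1)).2 =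
      (1 - q ^ 2 * (q ^ n * c₀) ^ 2) * (v n).2 + b ^ 2 * (q ^ n * c₀) ^ 2 * (v n).1 := by
    intro n
    rcases le_or_gt 0 n with hn | hn
    · rw [hup n hn]; exact ⟨rfl, rfl⟩
    · have h1 := congrArg Prod.fst (hdown n hn)
      have h2 := congrArg Prod.snd (hdown n hn)
      have hne : b ^ 2 * (q ^ n * c₀) ^ 2 ≠ 0 :=
        mul_ne_zero (pow_ne_zero _ hb) (pow_ne_zero _ (mul_ne_zero (zpow_ne_zero _ hq0) hc))
      simp only at h1 h2
      refine ⟨h2.symm, ?_⟩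
      rw [h1, h2, mul_div_cancel₀ _ hne]
      ring
  refine ⟨fun n => (v n).1, by simp [h0], ?_, ?_⟩
  · have := (key 0).1
    rw [h0] at this
    simpa using this
  · intro n
    have h1 := key n
    have h2 := key (n + 1)
    have : n + 2 = n + 1 + 1 := by ring
    simp only [this]
    rw [h2.1, h1.2, h1.1]

/-- The Casoratian of two sequences does not vanish if it does not vanish at `0`. -/
theorem casoratian_ne_zero {q b c₀ : ℂ} (hq0 : q ≠ 0) (hb : b ≠ 0) (hc : c₀ ≠ 0) {u w : ℤ → ℂ}
    (hu : IsOrbitSeq q b c₀ u) (hw : IsOrbitSeq q b c₀ w) (h0 : u 0 * w 1 - u 1 * w 0 ≠ 0)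
    (n : ℤ) : u n * w (n + 1) - u (n + 1) * w n ≠ 0 := by
  have step : ∀ n : ℤ, u (n + 1) * w (n + 1 + 1) - u (n + 1 + 1) * w (n + 1) =
      -(b ^ 2 * (q ^ n * c₀) ^ 2) * (u n * w (n + 1) - u (n + 1) * w n) := by
    intro n
    have : n + 1 + 1 = n + 2 := by ring
    rw [this, hu n, hw n]; ring
  have hne : ∀ n : ℤ, -(b ^ 2 * (q ^ n * c₀) ^ 2) ≠ 0 := fun n => neg_ne_zero.2 <|
    mul_ne_zero (pow_ne_zero _ hb) (pow_ne_zero _ (mul_ne_zero (zpow_ne_zero _ hq0) hc))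
  induction n using Int.induction_on with
  | zero => simpa using h0
  | succ k ih => rw [step]; exact mul_ne_zero (hne _) ih
  | pred k ih =>
    have := step (-(k : ℤ) - 1)
    rw [sub_add_cancel] at this
    rw [this] at ih
    rw [sub_add_cancel]
    exact right_ne_zero_of_mul ih

/-- Such $c$ are roots of every coefficient of `W`, one of which is a nonzero polynomial. -/
theorem finite_setOf_map_eq_zero {W : ℂ[X][X]} (hW : W ≠ 0) :
    {c : ℂ | W.map (evalRingHom c) = 0}.Finite := by
  obtain ⟨k, hk⟩ : ∃ k, W.coeff k ≠ 0 := by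
    by_contra! h
    exact hW (Polynomial.ext (by simpa using h))
  refine (finite_setOfPred_isRoot hk).subset fun c hc => ?_
  have := congrArg (fun p => coeff p k) (Set.mem_ofPred_eq ▸ hc)
  simpa using this

/-- For all `c₀` and `t` outside countable sets, a non-zero polynomial does not vanish along the
orbit of `c₀` on the ratios of consecutive values of the solution with initial values `1, t`. -/
theorem exists_countable_generic {q b : ℂ} (hq0 : q ≠ 0) (hb : b ≠ 0) {W : ℂ[X][X]} (hW : W ≠ 0) :
    ∃ C : Set ℂ, C.Countable ∧ ∀ c₀ : ℂ, c₀ ∉ C → c₀ ≠ 0 → ∀ u : ℂ → ℤ → ℂ,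
      (∀ t, u t 0 = 1 ∧ u t 1 = t ∧ IsOrbitSeq q b c₀ (u t)) →
      ∃ E : Set ℂ, E.Countable ∧ ∀ t, t ∉ E → ∀ n,
        u t n ≠ 0 ∧ W.evalEval (q ^ n * c₀) (u t (n + 1) / u t n) ≠ 0 := by
  refine ⟨⋃ n : ℤ, (fun c => q ^ n * c) ⁻¹' {c : ℂ | W.map (evalRingHom c) = 0}, ?_, ?_⟩
  · refine Set.countable_iUnion fun n => Set.Countable.preimage_of_injOn ?_ ?_
    · exact (finite_setOf_map_eq_zero hW).countable
    · exact (mul_right_injective₀ (zpow_ne_zero n hq0)).injOn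
  intro c₀ hC hc u hu
  -- The Casoratian at $0$ is $t-s$. Hence at each $n$ at most one parameter gives $u_n=0$, and
  -- distinct parameters give distinct ratios $u_{n+1}/u_n$.
  have hcas : ∀ s t, s ≠ t → ∀ n, u s n * u t (n + 1) - u s (n + 1) * u t n ≠ 0 := by
    intro s t hst n
    refine casoratian_ne_zero hq0 hb hc (hu s).2.2 (hu t).2.2 ?_ n
    rw [(hu s).1, (hu s).2.1, (hu t).1, (hu t).2.1]
    intro h
    apply hst
    linear_combination -h
  have hzero : ∀ n, {t | u t n = 0}.Countable := by
    intro n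
    refine Set.Subsingleton.countable fun s hs t ht => ?_
    by_contra hst
    apply hcas s t hst n
    simp only [Set.mem_ofPred_eq] at hs ht
    rw [hs, ht]; ring
  have hroot : ∀ n, {t | u t n ≠ 0 ∧
      W.evalEval (q ^ n * c₀) (u t (n + 1) / u t n) = 0}.Countable := by
    intro n
    have hWn : W.map (evalRingHom (q ^ n * c₀)) ≠ 0 := by
      intro h
      exact hC (Set.mem_iUnion.2 ⟨n, h⟩)
    have hfin := (finite_setOfPred_isRoot hWn).countable
    refine Set.MapsTo.countable_of_injOn (f := fun t => u t (n + 1) / u t n)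
      (t := {x | IsRoot (W.map (evalRingHom (q ^ n * c₀))) x}) ?_ ?_ hfin
    · intro t ht
      simpa [IsRoot, map_evalRingHom_eval] using ht.2
    · intro s hs t ht hst
      by_contra hne
      apply hcas s t hne n
      have h1 := hs.1
      have h2 := ht.1
      simp only at hst
      rw [div_eq_div_iff h1 h2] at hst
      linear_combination -hst
  refine ⟨(⋃ n, {t | u t n = 0}) ∪ ⋃ n, {t | u t n ≠ 0 ∧
      W.evalEval (q ^ n * c₀) (u t (n + 1) / u t n) = 0},
    (Set.countable_iUnion hzero).union (Set.countable_iUnion hroot), fun t ht n => ?_⟩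
  simp only [Set.mem_union, Set.mem_iUnion, Set.mem_ofPred_eq, not_or, not_exists, not_and] at ht
  exact ⟨ht.1 n, ht.2 n (ht.1 n)⟩

/-- A solution of the second order equation, for all indices `ν ≥ 0`, and for all indices when the
lowering operators exist. -/
theorem exists_contiguous_seq {q b c₀ : ℂ} (hq0 : q ≠ 0) (hc : c₀ ≠ 0) {u : ℤ → ℂ}
    (hu : IsOrbitSeq q b c₀ u) :
    ∃ v : ℤ → ℤ → ℂ, v 0 = u ∧ ∀ ν : ℤ, (0 ≤ ν ∨ ∀ l : ℤ, b ^ 2 ≠ q ^ (2 * l)) → ∀ n : ℤ,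
      v (ν + 1) (n + 1) = v ν (n + 1) + b ^ 2 * q ^ (2 * ν) * (q ^ n * c₀) ^ 2 * v ν n ∧
      v (ν + 1) n = v ν (n + 1) + (q ^ n * c₀) ^ 2 * v ν n := by
  obtain ⟨v, h0, hup, hdown⟩ := exists_int_seq u
    (fun _ x n => x (n + 1) + (q ^ n * c₀) ^ 2 * x n)
    -- Subtracting the two contiguity relations gives
    -- $G_{\nu+1}(c)-G_{\nu+1}(qc)=c^2(1-b^2q^{2\nu})G_\nu(c)$, which determines the lowering
    -- operator.
    (fun ν x n => (x n - x (n + 1)) / ((q ^ n * c₀) ^ 2 * (1 - b ^ 2 * q ^ (2 * ν))))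
  have hpow : ∀ ν : ℤ, q ^ (2 * (ν + 1)) = q ^ (2 * ν) * q ^ 2 := by
    intro ν
    rw [mul_add, zpow_add₀ hq0]; norm_cast
  have hc' : ∀ n : ℤ, q ^ n * c₀ ≠ 0 := fun n => mul_ne_zero (zpow_ne_zero _ hq0) hc
  -- At level $\nu$ the second order equation has $b^2q^{2\nu}$ in place of $b^2$; given the second
  -- contiguity relation, it is equivalent to the first.
  let rec_at : ℤ → Prop := fun ν => ∀ n : ℤ, v ν (n + 1 + 1) =
    (1 - q ^ 2 * (q ^ n * c₀) ^ 2) * v ν (n + 1) +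
      b ^ 2 * q ^ (2 * ν) * (q ^ n * c₀) ^ 2 * v ν n
  have r0 : rec_at 0 := by
    intro n
    have := hu n
    rw [h0, add_assoc]
    simpa using this
  have rup : ∀ ν, 0 ≤ ν → rec_at ν → rec_at (ν + 1) := by
    intro ν hν hr n
    have e1 := hr n
    have e2 := hr (n + 1)
    rw [hup ν hν, hpow]
    simp only [zpow_orbit_succ hq0] at e2 ⊢
    rw [e2, e1]
    ring
  have rpos : ∀ k : ℕ, rec_at k := by
    intro k
    induction k with
    | zero => exact r0
    | succ k ih => exact_mod_cast rup k (by positivity) ih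
  have down : (∀ l : ℤ, b ^ 2 ≠ q ^ (2 * l)) → ∀ ν < 0, rec_at (ν + 1) → ∀ n : ℤ,
      v (ν + 1) (n + 1) = v ν (n + 1) + b ^ 2 * q ^ (2 * ν) * (q ^ n * c₀) ^ 2 * v ν n ∧
      v (ν + 1) n = v ν (n + 1) + (q ^ n * c₀) ^ 2 * v ν n := by
    intro hl ν hν hr n
    have hne : 1 - b ^ 2 * q ^ (2 * ν) ≠ 0 := by
      intro h
      apply hl (-ν)
      rw [mul_neg, zpow_neg]
      exact eq_inv_of_mul_eq_one_left (by linear_combination -h)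
    have e1 := hr n
    have hcn := hc' n
    rw [hpow] at e1
    rw [hdown ν hν]
    simp only [zpow_orbit_succ hq0]
    rw [e1]
    constructor
    · field_simp
      ring
    · field_simp
      ring
  have rdown : (∀ l : ℤ, b ^ 2 ≠ q ^ (2 * l)) → ∀ ν < 0, rec_at (ν + 1) → rec_at ν := by
    intro hl ν hν hr n
    have e1 := (down hl ν hν hr n).1
    have e2 := (down hl ν hν hr (n + 1)).2
    simp only [zpow_orbit_succ hq0] at e2
    linear_combination e1 - e2
  have rneg : (∀ l : ℤ, b ^ 2 ≠ q ^ (2 * l)) → ∀ k : ℕ, rec_at (-k) := by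
    intro hl k
    induction k with
    | zero => exact r0
    | succ k ih =>
      apply rdown hl _ (by push_cast; lia)
      convert ih using 1
      push_cast; ring
  refine ⟨v, h0, fun ν hν n => ?_⟩
  rcases le_or_gt 0 ν with hν0 | hν0
  · obtain ⟨k, rfl⟩ := Int.eq_ofNat_of_zero_le hν0
    have e1 := rpos k n
    rw [hup _ hν0]
    simp only [zpow_orbit_succ hq0]
    refine ⟨?_, trivial⟩
    rw [e1]; ring
  · have hl : ∀ l : ℤ, b ^ 2 ≠ q ^ (2 * l) := hν.resolve_left (by lia)
    refine down hl ν hν0 ?_ n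
    obtain ⟨k, hk⟩ := Int.eq_ofNat_of_zero_le (a := -(ν + 1)) (by lia)
    have := rneg hl k
    rwa [show -(k : ℤ) = ν + 1 by lia] at this

/-! ### Bäcklund transformations of the system -/

theorem qP4Den_zero (a x : Fin 3 → ℂ) :
    qP4Den a x 0 = 1 + a 0 * x 0 + a 0 * a 1 * x 0 * x 1 := rfl

theorem qP4Den_one (a x : Fin 3 → ℂ) :
    qP4Den a x 1 = 1 + a 1 * x 1 + a 1 * a 2 * x 1 * x 2 := rfl

theorem qP4Den_two (a x : Fin 3 → ℂ) :
    qP4Den a x 2 = 1 + a 2 * x 2 + a 2 * a 0 * x 2 * x 0 := rfl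

/-- The system written out for `j = 0, 1, 2`. -/
theorem isQP4Solution_iff {a : Fin 3 → ℂ} {D : Set ℂ} {f : Fin 3 → ℂ → ℂ} :
    IsQP4Solution a D f ↔ ∀ c ∈ D,
      f 0 c * f 1 c * f 2 c = qConst a * c ^ 2 ∧
      (qP4Den a (fun l => f l c) 0 ≠ 0 ∧ qP4Den a (fun l => f l c) 1 ≠ 0 ∧
        qP4Den a (fun l => f l c) 2 ≠ 0) ∧
      f 0 (qConst a * c) = a 0 * a 1 * f 1 c *
        (qP4Den a (fun l => f l c) 2 / qP4Den a (fun l => f l c) 0) ∧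
      f 1 (qConst a * c) = a 1 * a 2 * f 2 c *
        (qP4Den a (fun l => f l c) 0 / qP4Den a (fun l => f l c) 1) ∧
      f 2 (qConst a * c) = a 2 * a 0 * f 0 c *
        (qP4Den a (fun l => f l c) 1 / qP4Den a (fun l => f l c) 2) := by
  refine forall₂_congr fun c _ => and_congr_right fun _ => ?_
  rw [Fin.forall_fin_succ, Fin.forall_fin_succ, Fin.forall_fin_one]
  constructor
  · rintro ⟨⟨h0, e0⟩, ⟨h1, e1⟩, h2, e2⟩
    exact ⟨⟨h0, h1, h2⟩, e0, e1, e2⟩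
  · rintro ⟨⟨h0, h1, h2⟩, e0, e1, e2⟩
    exact ⟨⟨h0, e0⟩, ⟨h1, e1⟩, h2, e2⟩

theorem IsQP4Solution.congr {a : Fin 3 → ℂ} {D : Set ℂ} {f g : Fin 3 → ℂ → ℂ}
    (hD : ∀ c ∈ D, qConst a * c ∈ D) (hf : IsQP4Solution a D f)
    (hfg : ∀ c ∈ D, ∀ j, g j c = f j c) : IsQP4Solution a D g := by
  intro c hc
  have h := hf c hc
  simp only [hfg c hc, hfg _ (hD c hc)]
  exact h

/-- The simple reflection `s₀` on the parameters. -/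
noncomputable def reflectParam (a : Fin 3 → ℂ) : Fin 3 → ℂ := ![(a 0)⁻¹, a 0 * a 1, a 0 * a 2]

theorem qConst_reflectParam {a : Fin 3 → ℂ} (h0 : a 0 ≠ 0) :
    qConst (reflectParam a) = qConst a := by
  simp only [qConst, reflectParam, Matrix.cons_val]
  field_simp

/-- With `IsQP4Solution.den_mul_one_add`, this describes at $qc$ the factors $a_0+f_0$ and
$1+a_0f_0$ of $s_0$. It also shows that neither can vanish at two consecutive points unless
$a_0^2=1$. -/
theorem IsQP4Solution.den_mul_add {a : Fin 3 → ℂ} {D : Set ℂ} {f : Fin 3 → ℂ → ℂ}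
    (hf : IsQP4Solution a D f) {c : ℂ} (hc : c ∈ D) :
    qP4Den a (fun l => f l c) 0 * (a 0 + f 0 (qConst a * c)) =
      a 0 * (1 + a 0 * f 0 c) * qP4Den a (fun l => f l c) 1 := by
  obtain ⟨-, ⟨h0, -, -⟩, e0, -, -⟩ := isQP4Solution_iff.1 hf c hc
  rw [e0, mul_add, mul_left_comm, mul_div_cancel₀ _ h0]
  simp only [qP4Den_zero, qP4Den_one, qP4Den_two]
  ring

theorem IsQP4Solution.den_mul_one_add {a : Fin 3 → ℂ} {D : Set ℂ} {f : Fin 3 → ℂ → ℂ}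
    (hf : IsQP4Solution a D f) {c : ℂ} (hc : c ∈ D) :
    qP4Den a (fun l => f l c) 0 * (1 + a 0 * f 0 (qConst a * c)) =
      (1 + a 0 * f 0 c) * (1 + a 0 ^ 2 * a 1 * a 2 * f 1 c * f 2 c) +
        a 0 * a 1 * f 1 c * (a 0 + f 0 c) := by
  obtain ⟨-, ⟨h0, -, -⟩, e0, -, -⟩ := isQP4Solution_iff.1 hf c hc
  have : qP4Den a (fun l => f l c) 0 * (1 + a 0 * f 0 (qConst a * c)) =
      qP4Den a (fun l => f l c) 0 + a 0 * (a 0 * a 1 * f 1 c * qP4Den a (fun l => f l c) 2) := by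
    rw [e0]; field_simp
  rw [this]
  simp only [qP4Den_zero, qP4Den_two]
  ring

theorem IsQP4Solution.sq_eq_one_of_add {a : Fin 3 → ℂ} (ha : a 0 ≠ 0) {D : Set ℂ}
    {f : Fin 3 → ℂ → ℂ} (hf : IsQP4Solution a D f) {c : ℂ} (hc : c ∈ D)
    (h : a 0 + f 0 c = 0) (h' : a 0 + f 0 (qConst a * c) = 0) : a 0 ^ 2 = 1 := by
  have key := hf.den_mul_add hc
  obtain ⟨-, ⟨-, h1, -⟩, -⟩ := isQP4Solution_iff.1 hf c hc
  rw [h', mul_zero, eq_comm, mul_eq_zero, mul_eq_zero] at key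
  have := (key.resolve_right h1).resolve_left ha
  linear_combination -this + a 0 * h

theorem IsQP4Solution.sq_eq_one_of_one_add {a : Fin 3 → ℂ} (ha : ∀ j, a j ≠ 0) {D : Set ℂ}
    {f : Fin 3 → ℂ → ℂ} (hf : IsQP4Solution a D f) {c : ℂ} (hc : c ∈ D) (hc0 : c ≠ 0)
    (h : 1 + a 0 * f 0 c = 0) (h' : 1 + a 0 * f 0 (qConst a * c) = 0) : a 0 ^ 2 = 1 := by
  have key := hf.den_mul_one_add hc
  have hprod := (hf c hc).1
  have hf1 : f 1 c ≠ 0 := by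
    intro hz
    rw [hz] at hprod
    have : qConst a * c ^ 2 ≠ 0 :=
      mul_ne_zero (mul_ne_zero (mul_ne_zero (ha 0) (ha 1)) (ha 2)) (pow_ne_zero _ hc0)
    apply this
    rw [← hprod]; ring
  rw [h', h, mul_zero, zero_mul, zero_add, eq_comm, mul_eq_zero] at key
  have := key.resolve_left (mul_ne_zero (mul_ne_zero (ha 0) (ha 1)) hf1)
  linear_combination a 0 * this - h

/-- The Bäcklund transformation `s₀`. -/
theorem IsQP4Solution.reflect {a : Fin 3 → ℂ} (ha : a 0 ≠ 0) {D : Set ℂ}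
    (hD : ∀ c ∈ D, qConst a * c ∈ D) {f : Fin 3 → ℂ → ℂ} (hf : IsQP4Solution a D f)
    (hA : ∀ c ∈ D, a 0 + f 0 c ≠ 0) (hB : ∀ c ∈ D, 1 + a 0 * f 0 c ≠ 0) :
    IsQP4Solution (reflectParam a) D
      ![f 0, fun c => f 1 c * ((a 0 + f 0 c) / (1 + a 0 * f 0 c)),
        fun c => f 2 c * ((1 + a 0 * f 0 c) / (a 0 + f 0 c))] := by
  rw [isQP4Solution_iff]
  intro c hc
  have eA := hf.den_mul_add hc
  have eB := hf.den_mul_one_add hc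
  have hA' := hA _ (hD c hc)
  have hB' := hB _ (hD c hc)
  have hAc := hA c hc
  have hBc := hB c hc
  obtain ⟨hprod, ⟨h0, h1, h2⟩, e0, e1, e2⟩ := isQP4Solution_iff.1 hf c hc
  rw [qConst_reflectParam ha]
  -- Each reflected denominator is an old one times factors $a_0+f_0$ and $1+a_0f_0$ at $c$ or $qc$,
  -- so nonvanishing is inherited and the system reduces to cancellation.
  have d0 : (1 : ℂ) + (a 0)⁻¹ * f 0 c + (a 0)⁻¹ * (a 0 * a 1) * f 0 c *
      (f 1 c * ((a 0 + f 0 c) / (1 + a 0 * f 0 c))) =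
      (a 0 + f 0 c) / (a 0 * (1 + a 0 * f 0 c)) * qP4Den a (fun l => f l c) 0 := by
    rw [qP4Den_zero]; field_simp
  have d1 : (1 : ℂ) + a 0 * a 1 * (f 1 c * ((a 0 + f 0 c) / (1 + a 0 * f 0 c))) +
      a 0 * a 1 * (a 0 * a 2) * (f 1 c * ((a 0 + f 0 c) / (1 + a 0 * f 0 c))) *
        (f 2 c * ((1 + a 0 * f 0 c) / (a 0 + f 0 c))) =
      qP4Den a (fun l => f l c) 0 * (1 + a 0 * f 0 (qConst a * c)) / (1 + a 0 * f 0 c) := by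
    rw [eB]; field_simp; ring
  have d2 : (1 : ℂ) + a 0 * a 2 * (f 2 c * ((1 + a 0 * f 0 c) / (a 0 + f 0 c))) +
      a 0 * a 2 * (a 0)⁻¹ * (f 2 c * ((1 + a 0 * f 0 c) / (a 0 + f 0 c))) * f 0 c =
      qP4Den a (fun l => f l c) 2 := by
    rw [qP4Den_two]; field_simp; ring
  have eA' : a 0 + f 0 (qConst a * c) =
      a 0 * (1 + a 0 * f 0 c) * qP4Den a (fun l => f l c) 1 / qP4Den a (fun l => f l c) 0 := by
    rw [eq_div_iff h0, ← eA]; ring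
  simp only [qP4Den_zero (reflectParam a), qP4Den_one (reflectParam a),
    qP4Den_two (reflectParam a)]
  simp only [reflectParam, Matrix.cons_val]
  rw [d0, d1, d2]
  generalize qP4Den a (fun l => f l c) 0 = N0 at *
  generalize qP4Den a (fun l => f l c) 1 = N1 at *
  generalize qP4Den a (fun l => f l c) 2 = N2 at *
  refine ⟨?_, ⟨?_, ?_, h2⟩, ?_, ?_, ?_⟩
  · rw [← hprod]
    generalize 1 + a 0 * f 0 c = Z at *
    field_simp
  · exact mul_ne_zero (div_ne_zero hAc (mul_ne_zero ha hBc)) h0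
  · exact div_ne_zero (mul_ne_zero h0 hB') hBc
  · rw [e0]; field_simp
  · rw [e1, eA']; generalize 1 + a 0 * f 0 (qConst a * c) = Z at *; field_simp
  · rw [e2, eA']; generalize 1 + a 0 * f 0 (qConst a * c) = Z at *; field_simp

/-- The limiting form of the Bäcklund transformation `s₀` when `a₀ = ±1`. -/
theorem IsQP4Solution.reflect_of_sq_eq_one {a : Fin 3 → ℂ} (ha : a 0 ^ 2 = 1) {D : Set ℂ}
    {f : Fin 3 → ℂ → ℂ} (hf : IsQP4Solution a D f) :
    IsQP4Solution (reflectParam a) D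
      ![f 0, fun c => a 0 * f 1 c, fun c => a 0 * f 2 c] := by
  have ha0 : a 0 ≠ 0 := by
    rintro h
    rw [h] at ha
    norm_num at ha
  have hinv : (a 0)⁻¹ = a 0 := inv_eq_of_mul_eq_one_left (by rw [← ha]; ring)
  rw [isQP4Solution_iff]
  intro c hc
  obtain ⟨hprod, ⟨h0, h1, h2⟩, e0, e1, e2⟩ := isQP4Solution_iff.1 hf c hc
  rw [qConst_reflectParam ha0]
  have d0 : (1 : ℂ) + a 0 * f 0 c + a 0 * (a 0 * a 1) * f 0 c * (a 0 * f 1 c) =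
      qP4Den a (fun l => f l c) 0 := by
    rw [qP4Den_zero]
    linear_combination a 0 * a 1 * f 0 c * f 1 c * ha
  have d1 : (1 : ℂ) + a 0 * a 1 * (a 0 * f 1 c) +
      a 0 * a 1 * (a 0 * a 2) * (a 0 * f 1 c) * (a 0 * f 2 c) =
      qP4Den a (fun l => f l c) 1 := by
    rw [qP4Den_one]
    linear_combination (a 1 * f 1 c + (a 0 ^ 2 + 1) * a 1 * a 2 * f 1 c * f 2 c) * ha
  have d2 : (1 : ℂ) + a 0 * a 2 * (a 0 * f 2 c) + a 0 * a 2 * a 0 * (a 0 * f 2 c) * f 0 c =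
      qP4Den a (fun l => f l c) 2 := by
    rw [qP4Den_two]
    linear_combination (a 2 * f 2 c + a 0 * a 2 * f 2 c * f 0 c) * ha
  simp only [qP4Den_zero (reflectParam a), qP4Den_one (reflectParam a),
    qP4Den_two (reflectParam a)]
  simp only [reflectParam, Matrix.cons_val, hinv]
  rw [d0, d1, d2]
  refine ⟨?_, ⟨h0, h1, h2⟩, ?_, ?_, ?_⟩
  · rw [← hprod]
    linear_combination f 0 c * f 1 c * f 2 c * ha
  · rw [e0]
    linear_combination -(a 0 * a 1 * f 1 c * (qP4Den a (fun l => f l c) 2 /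
      qP4Den a (fun l => f l c) 0)) * ha
  · rw [e1]
    linear_combination -(a 0 * a 1 * a 2 * f 2 c * (qP4Den a (fun l => f l c) 0 /
      qP4Den a (fun l => f l c) 1)) * ha
  · rw [e2]
    ring

theorem qConst_rotate (a : Fin 3 → ℂ) (r : Fin 3) : qConst (fun j => a (j + r)) = qConst a := by
  fin_cases r
  · rfl
  · change a 1 * a 2 * a 0 = a 0 * a 1 * a 2
    ring
  · change a 2 * a 0 * a 1 = a 0 * a 1 * a 2
    ring

/-- The system is invariant under rotation of the indices. -/
theorem IsQP4Solution.rotate {a : Fin 3 → ℂ} {D : Set ℂ} {f : Fin 3 → ℂ → ℂ}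
    (hf : IsQP4Solution a D f) (r : Fin 3) :
    IsQP4Solution (fun j => a (j + r)) D (fun j => f (j + r)) := by
  intro c hc
  obtain ⟨hprod, h⟩ := hf c hc
  rw [qConst_rotate]
  have hden : ∀ j, qP4Den (fun j => a (j + r)) (fun l => f (l + r) c) j =
      qP4Den a (fun l => f l c) (j + r) := by
    intro j
    simp only [qP4Den, add_right_comm]
  refine ⟨?_, fun j => ?_⟩
  · rw [← hprod]
    exact qConst_rotate (fun j => f j c) r
  · rw [hden, hden]
    have := h (j + r)
    rw [add_right_comm j r 1, add_right_comm j r 2] at this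
    exact this

/-! ### Families of solutions rational in $c$ and $h$ -/

/-- The Riccati equation satisfied by the ratios `h(c) = G₀(qc) / G₀(c)`. -/
def IsRiccati (q b : ℂ) (D : Set ℂ) (h : ℂ → ℂ) : Prop :=
  ∀ c ∈ D, h c ≠ 0 ∧ h (q * c) = 1 - q ^ 2 * c ^ 2 + b ^ 2 * c ^ 2 / h c

/-- The triple `p j / r j` of rational functions in `(c, h)` gives an injectively parametrized
solution with parameters `a` for every solution `h` of the Riccati equation. -/
structure IsRiccatiFamily (b : ℂ) (a : Fin 3 → ℂ) (p r : Fin 3 → ℂ[X][X]) : Prop where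
  ne_zero : ∀ j, r j ≠ 0
  isSolution : ∀ (D : Set ℂ) (h : ℂ → ℂ), (0 : ℂ) ∉ D → (∀ c ∈ D, qConst a * c ∈ D) →
    IsRiccati (qConst a) b D h → (∀ c ∈ D, ∀ j, (r j).evalEval c (h c) ≠ 0) →
    IsQP4Solution a D fun j c => (p j).evalEval c (h c) / (r j).evalEval c (h c)
  injective : ∀ c x y : ℂ, c ≠ 0 →
    (∀ j, (r j).evalEval c x ≠ 0) → (∀ j, (r j).evalEval c y ≠ 0) →
    (∀ j, (p j).evalEval c x / (r j).evalEval c x = (p j).evalEval c y / (r j).evalEval c y) →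
    x = y

/-- There is a Riccati family for the parameters `a`. -/
def HasRiccatiFamily (b : ℂ) (a : Fin 3 → ℂ) : Prop := ∃ p r, IsRiccatiFamily b a p r

/-- For $a_0=1$ the constraint $f_0=-1$ is preserved, and $f_1f_2=-qc^2$ leaves one unknown. Setting
$f_2=-a_2h$ turns its evolution into the Riccati equation. -/
theorem hasRiccatiFamily_seed {a : Fin 3 → ℂ} (ha : ∀ j, a j ≠ 0) (h0 : a 0 = 1) :
    HasRiccatiFamily (a 1) a := by
  refine ⟨![-1, C (C (a 1) * X ^ 2), C (C (-a 2)) * X], ![1, X, 1], ?_, ?_, ?_⟩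
  · intro j
    fin_cases j <;> simp
  · intro D h hD0 hD hh _
    rw [isQP4Solution_iff]
    intro c hc
    have hq : qConst a = a 1 * a 2 := by rw [qConst, h0, one_mul]
    have hc0 : c ≠ 0 := fun e => hD0 (e ▸ hc)
    obtain ⟨hx, hx'⟩ := hh c hc
    have hx1 := (hh _ (hD c hc)).1
    have h1 := ha 1
    have h2 := ha 2
    simp only [qP4Den_zero, qP4Den_one, qP4Den_two]
    simp [h0, evalEval_C]
    -- By the Riccati equation this denominator is $h(qc)$, so it is nonzero.
    have d1 : 1 + a 1 * (a 1 * c ^ 2 / h c) + -(a 1 * a 2 * (a 1 * c ^ 2 / h c) * (a 2 * h c)) =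
        h (qConst a * c) := by
      rw [hx', hq]; field_simp; ring
    rw [d1]
    generalize h (qConst a * c) = y at *
    rw [hq]
    refine ⟨?_, ?_, ?_, ?_, ?_⟩
    · field_simp
    · exact ⟨⟨h1, ⟨h1, hc0⟩, hx⟩, hx1⟩
    · field_simp
    · field_simp
    · exact Or.inl rfl
  · intro c x y _ _ _ h
    have := h 2
    simpa [ha 2] using this

theorem HasRiccatiFamily.rotate {b : ℂ} {a : Fin 3 → ℂ} (h : HasRiccatiFamily b a) (s : Fin 3) :
    HasRiccatiFamily b (fun j => a (j + s)) := by
  obtain ⟨p, r, h⟩ := h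
  have hall : ∀ {Q : Fin 3 → Prop}, (∀ j, Q (j + s)) → ∀ j, Q j := by
    intro Q hQ j
    simpa using hQ (j - s)
  refine ⟨fun j => p (j + s), fun j => r (j + s), fun j => h.ne_zero _, ?_, ?_⟩
  · intro D g hD0 hD hg hr
    rw [qConst_rotate] at hD hg
    exact (h.isSolution D g hD0 hD hg fun c hc => hall (hr c hc)).rotate s
  · intro c x y hc hx hy hxy
    exact h.injective c x y hc (hall hx) (hall hy) (hall hxy)

/-- The function on the orbit of `c₀` with the values `u n` at `qⁿ c₀`. -/
noncomputable def orbitFun (q c₀ : ℂ) (u : ℤ → ℂ) : ℂ → ℂ :=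
  Function.extend (fun n : ℤ => q ^ n * c₀) u 0

theorem orbitFun_apply {q c₀ : ℂ} (hq0 : q ≠ 0) (hq : ∀ n : ℕ, 0 < n → q ^ n ≠ 1)
    (hc : c₀ ≠ 0) (u : ℤ → ℂ) (n : ℤ) : orbitFun q c₀ u (q ^ n * c₀) = u n :=
  (zpow_orbit_injective hq0 hq hc).extend_apply u 0 n

theorem orbitFun_apply_mul {q c₀ : ℂ} (hq0 : q ≠ 0) (hq : ∀ n : ℕ, 0 < n → q ^ n ≠ 1)
    (hc : c₀ ≠ 0) (u : ℤ → ℂ) (n : ℤ) : orbitFun q c₀ u (q * (q ^ n * c₀)) = u (n + 1) := by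
  rw [← zpow_orbit_succ hq0, orbitFun_apply hq0 hq hc]

theorem mul_mem_qOrbit {q c₀ : ℂ} (hq0 : q ≠ 0) {c : ℂ} (hc : c ∈ qOrbit q c₀) :
    q * c ∈ qOrbit q c₀ := by
  obtain ⟨n, rfl⟩ := hc
  exact ⟨n + 1, (zpow_orbit_succ hq0 c₀ n).symm⟩

theorem zero_notMem_qOrbit {q c₀ : ℂ} (hq0 : q ≠ 0) (hc : c₀ ≠ 0) : (0 : ℂ) ∉ qOrbit q c₀ := by
  rintro ⟨n, hn⟩
  exact mul_ne_zero (zpow_ne_zero n hq0) hc hn.symm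

theorem self_mem_qOrbit (q c₀ : ℂ) : c₀ ∈ qOrbit q c₀ := ⟨0, by simp⟩

/-- The ratios of a solution of the second order equation solve the Riccati equation. -/
theorem isRiccati_div {q b : ℂ} {D : Set ℂ} {g : ℂ → ℂ} (hD : ∀ c ∈ D, q * c ∈ D)
    (hg : ∀ c ∈ D, g c ≠ 0)
    (hrec : ∀ c ∈ D, g (q * (q * c)) = (1 - q ^ 2 * c ^ 2) * g (q * c) + b ^ 2 * c ^ 2 * g c) :
    IsRiccati q b D fun c => g (q * c) / g c := by
  intro c hc
  have h0 := hg c hc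
  have h1 := hg _ (hD c hc)
  refine ⟨div_ne_zero h1 h0, ?_⟩
  simp only
  rw [hrec c hc]
  field_simp

theorem exists_notMem_of_countable {C : Set ℂ} (hC : C.Countable) : ∃ c, c ∉ C := by
  by_contra! h
  have : C = Set.univ := Set.eq_univ_of_forall h
  exact not_countable_complex (this ▸ hC)

theorem qConst_ne_zero {a : Fin 3 → ℂ} (ha : ∀ j, a j ≠ 0) : qConst a ≠ 0 :=
  mul_ne_zero (mul_ne_zero (ha 0) (ha 1)) (ha 2)

/-- A Riccati family has a member defined on a whole orbit. -/
theorem IsRiccatiFamily.exists_isSolution {b : ℂ} {a : Fin 3 → ℂ} {p r : Fin 3 → ℂ[X][X]}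
    (hb : b ≠ 0) (ha : ∀ j, a j ≠ 0) (hq : ∀ n : ℕ, 0 < n → qConst a ^ n ≠ 1)
    (h : IsRiccatiFamily b a p r) :
    ∃ (c₀ : ℂ) (g : ℂ → ℂ), c₀ ≠ 0 ∧
      (∀ c ∈ qOrbit (qConst a) c₀, ∀ j, (r j).evalEval c (g c) ≠ 0) ∧
      IsQP4Solution a (qOrbit (qConst a) c₀)
        fun j c => (p j).evalEval c (g c) / (r j).evalEval c (g c) := by
  have hq0 := qConst_ne_zero ha
  obtain ⟨C, hC, hgen⟩ := exists_countable_generic (W := ∏ j, r j) hq0 hb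
    (Finset.prod_ne_zero_iff.2 fun j _ => h.ne_zero j)
  obtain ⟨c₀, hc₀⟩ := exists_notMem_of_countable (hC.union (Set.countable_singleton 0))
  simp only [Set.mem_union, Set.mem_singleton_iff, not_or] at hc₀
  choose u hu using fun t => exists_isOrbitSeq hq0 hb hc₀.2 t
  obtain ⟨E, hE, hE'⟩ := hgen c₀ hc₀.1 hc₀.2 u hu
  obtain ⟨t, ht⟩ := exists_notMem_of_countable hE
  have hr : ∀ c ∈ qOrbit (qConst a) c₀, ∀ j, (r j).evalEval c
      (orbitFun (qConst a) c₀ (u t) (qConst a * c) / orbitFun (qConst a) c₀ (u t) c) ≠ 0 := by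
    rintro _ ⟨n, rfl⟩ j
    have := (hE' t ht n).2
    rw [evalEval_prod, Finset.prod_ne_zero_iff] at this
    rw [orbitFun_apply_mul hq0 hq hc₀.2, orbitFun_apply hq0 hq hc₀.2]
    exact this j (Finset.mem_univ j)
  refine ⟨c₀, _, hc₀.2, hr, h.isSolution _ _ (zero_notMem_qOrbit hq0 hc₀.2)
    (fun c hc => mul_mem_qOrbit hq0 hc) (isRiccati_div (fun c hc => mul_mem_qOrbit hq0 hc) ?_ ?_)
    hr⟩
  · rintro _ ⟨n, rfl⟩
    rw [orbitFun_apply hq0 hq hc₀.2]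
    exact (hE' t ht n).1
  · rintro _ ⟨n, rfl⟩
    rw [← zpow_orbit_succ hq0, orbitFun_apply_mul hq0 hq hc₀.2, orbitFun_apply hq0 hq hc₀.2,
      orbitFun_apply hq0 hq hc₀.2, add_assoc]
    exact (hu t).2.2 n

theorem HasRiccatiFamily.reflect {b : ℂ} {a : Fin 3 → ℂ} (hb : b ≠ 0) (ha : ∀ j, a j ≠ 0)
    (hq : ∀ n : ℕ, 0 < n → qConst a ^ n ≠ 1) (h : HasRiccatiFamily b a) :
    HasRiccatiFamily b (reflectParam a) := by
  obtain ⟨p, r, h⟩ := h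
  -- If $a_0^2=1$, then $a_0+f_0=a_0(1+a_0f_0)$, and the factor of $s_0$ is replaced by the constant
  -- $a_0$. This covers the seed, where both sides vanish identically.
  by_cases hsq : a 0 ^ 2 = 1
  · refine ⟨![p 0, C (C (a 0)) * p 1, C (C (a 0)) * p 2], r, h.ne_zero, ?_, ?_⟩
    · intro D g hD0 hD hg hr
      rw [qConst_reflectParam (ha 0)] at hD hg
      refine (h.isSolution D g hD0 hD hg hr).reflect_of_sq_eq_one hsq |>.congr ?_ ?_
      · rwa [qConst_reflectParam (ha 0)]
      · intro c hc j
        fin_cases j <;> simp [evalEval_mul, mul_div_assoc]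
    · intro c x y hc hx hy hxy
      refine h.injective c x y hc hx hy fun j => ?_
      have := hxy j
      fin_cases j
      · exact this
      · simpa [evalEval_mul, mul_div_assoc, ha 0] using this
      · simpa [evalEval_mul, mul_div_assoc, ha 0] using this
  -- One actual member of the family suffices: if $A=a_0r_0+p_0$ or $B=r_0+a_0p_0$ were the zero
  -- polynomial, this member would satisfy $a_0+f_0=0$ or $1+a_0f_0=0$ at $c_0$ and $qc_0$, forcing
  -- $a_0^2=1$.
  obtain ⟨c₀, g₀, hc₀, hr₀, hsol⟩ := h.exists_isSolution hb ha hq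
  have hmem := self_mem_qOrbit (qConst a) c₀
  have hmem' := mul_mem_qOrbit (qConst_ne_zero ha) hmem
  have evA : ∀ c x, (C (C (a 0)) * r 0 + p 0).evalEval c x =
      a 0 * (r 0).evalEval c x + (p 0).evalEval c x := by
    intro c x; simp [evalEval_add, evalEval_mul]
  have evB : ∀ c x, (r 0 + C (C (a 0)) * p 0).evalEval c x =
      (r 0).evalEval c x + a 0 * (p 0).evalEval c x := by
    intro c x; simp [evalEval_add, evalEval_mul]
  have hA : C (C (a 0)) * r 0 + p 0 ≠ 0 := by
    intro hz
    have key : ∀ c ∈ qOrbit (qConst a) c₀,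
        a 0 + (p 0).evalEval c (g₀ c) / (r 0).evalEval c (g₀ c) = 0 := by
      intro c hc
      have := hr₀ c hc 0
      field_simp
      have e := evA c (g₀ c)
      rw [hz, evalEval_zero] at e
      linear_combination -e
    exact hsq (hsol.sq_eq_one_of_add (ha 0) hmem (key _ hmem) (key _ hmem'))
  have hB : r 0 + C (C (a 0)) * p 0 ≠ 0 := by
    intro hz
    have key : ∀ c ∈ qOrbit (qConst a) c₀,
        1 + a 0 * ((p 0).evalEval c (g₀ c) / (r 0).evalEval c (g₀ c)) = 0 := by
      intro c hc
      have := hr₀ c hc 0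
      field_simp
      have e := evB c (g₀ c)
      rw [hz, evalEval_zero] at e
      linear_combination -e
    exact hsq (hsol.sq_eq_one_of_one_add ha hmem hc₀ (key _ hmem) (key _ hmem'))
  generalize C (C (a 0)) * r 0 + p 0 = A at *
  generalize r 0 + C (C (a 0)) * p 0 = B at *
  have hne : ∀ {c x : ℂ}, (∀ j, (r j * (A * B)).evalEval c x ≠ 0) →
      (∀ j, (r j).evalEval c x ≠ 0) ∧ A.evalEval c x ≠ 0 ∧ B.evalEval c x ≠ 0 := by
    intro c x hx
    simp only [evalEval_mul, mul_ne_zero_iff] at hx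
    exact ⟨fun j => (hx j).1, (hx 0).2⟩
  have hAdiv : ∀ {c x : ℂ}, (r 0).evalEval c x ≠ 0 →
      a 0 + (p 0).evalEval c x / (r 0).evalEval c x = A.evalEval c x / (r 0).evalEval c x := by
    intro c x hx
    rw [evA]; field_simp
  have hBdiv : ∀ {c x : ℂ}, (r 0).evalEval c x ≠ 0 →
      1 + a 0 * ((p 0).evalEval c x / (r 0).evalEval c x) =
        B.evalEval c x / (r 0).evalEval c x := by
    intro c x hx
    rw [evB]; field_simp
  -- The common factor $AB$ encodes $A,B\ne0$ in the nonvanishing of the new denominators.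
  refine ⟨![p 0 * (A * B), p 1 * (A * A), p 2 * (B * B)], fun j => r j * (A * B),
    fun j => mul_ne_zero (h.ne_zero j) (mul_ne_zero hA hB), ?_, ?_⟩
  · intro D g hD0 hD hg hr
    rw [qConst_reflectParam (ha 0)] at hD hg
    have hr' := fun c hc => hne (hr c hc)
    refine ((h.isSolution D g hD0 hD hg fun c hc => (hr' c hc).1).reflect (ha 0) hD ?_ ?_).congr
      ?_ ?_
    · intro c hc
      obtain ⟨h0, h1, h2⟩ := hr' c hc
      rw [hAdiv (h0 0)]
      exact div_ne_zero h1 (h0 0)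
    · intro c hc
      obtain ⟨h0, h1, h2⟩ := hr' c hc
      rw [hBdiv (h0 0)]
      exact div_ne_zero h2 (h0 0)
    · rwa [qConst_reflectParam (ha 0)]
    · intro c hc j
      obtain ⟨h0, h1, h2⟩ := hr' c hc
      have h00 := h0 0
      have h01 := h0 1
      have h02 := h0 2
      fin_cases j
      · simp only [Fin.zero_eta, Matrix.cons_val, evalEval_mul]
        field_simp
      · simp only [Fin.mk_one, Matrix.cons_val, evalEval_mul]
        rw [hAdiv h00, hBdiv h00]
        field_simp
      · simp only [Fin.reduceFinMk, Matrix.cons_val, evalEval_mul]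
        rw [hAdiv h00, hBdiv h00]
        field_simp
  · intro c x y hc hx hy hxy
    obtain ⟨hx0, hxA, hxB⟩ := hne hx
    obtain ⟨hy0, hyA, hyB⟩ := hne hy
    have e0 := hxy 0
    have e1 := hxy 1
    have e2 := hxy 2
    simp only [Matrix.cons_val, evalEval_mul] at e0 e1 e2
    rw [mul_div_mul_right _ _ (mul_ne_zero hxA hxB),
      mul_div_mul_right _ _ (mul_ne_zero hyA hyB)] at e0
    -- Since $f_0$ is unchanged, it determines the ratio $A/B$; cancelling that recovers the old
    -- $f_1,f_2$.
    have eA : A.evalEval c x / (r 0).evalEval c x = A.evalEval c y / (r 0).evalEval c y := by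
      rw [← hAdiv (hx0 0), ← hAdiv (hy0 0), e0]
    have eB : B.evalEval c x / (r 0).evalEval c x = B.evalEval c y / (r 0).evalEval c y := by
      rw [← hBdiv (hx0 0), ← hBdiv (hy0 0), e0]
    have eAB : A.evalEval c x / B.evalEval c x = A.evalEval c y / B.evalEval c y := by
      have := congrArg₂ (· / ·) eA eB
      simpa only [div_div_div_cancel_right₀ (hx0 0), div_div_div_cancel_right₀ (hy0 0)] using this
    have eBA : B.evalEval c x / A.evalEval c x = B.evalEval c y / A.evalEval c y := by
      rw [← inv_div, eAB, inv_div]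
    have cancel : ∀ {s t z w : ℂ}, z ≠ 0 → s * (z * z) / (t * (z * w)) = s / t * (z / w) := by
      intro s t z w hz
      rw [mul_div_mul_comm, mul_div_mul_left _ _ hz]
    rw [cancel hxA, cancel hyA, eAB] at e1
    rw [mul_comm (A.evalEval c x), mul_comm (A.evalEval c y), cancel hxB, cancel hyB, eBA] at e2
    refine h.injective c x y hc hx0 hy0 fun j => ?_
    fin_cases j
    · exact e0
    · exact mul_right_cancel₀ (div_ne_zero hyA hyB) e1
    · exact mul_right_cancel₀ (div_ne_zero hyB hyA) e2

/-! ### Translations and the parameters $a_i=q^k$ -/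

theorem reflectParam_ne_zero {a : Fin 3 → ℂ} (ha : ∀ j, a j ≠ 0) (j : Fin 3) :
    reflectParam a j ≠ 0 := by
  fin_cases j
  · exact inv_ne_zero (ha 0)
  · exact mul_ne_zero (ha 0) (ha 1)
  · exact mul_ne_zero (ha 0) (ha 2)

/-- The translation `(a₀, a₁, a₂) ↦ (q a₀, a₁, a₂ / q)`. -/
theorem HasRiccatiFamily.translate {b : ℂ} {a : Fin 3 → ℂ} (hb : b ≠ 0) (ha : ∀ j, a j ≠ 0)
    (hq : ∀ n : ℕ, 0 < n → qConst a ^ n ≠ 1) (h : HasRiccatiFamily b a) :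
    HasRiccatiFamily b ![qConst a * a 0, a 1, a 2 / qConst a] := by
  have h1 := (h.reflect hb ha hq).rotate 1
  have h2 := (h1.reflect hb (fun j => reflectParam_ne_zero ha _)
    (by rwa [qConst_rotate, qConst_reflectParam (ha 0)])).rotate 1
  have ha0 := ha 0
  have ha1 := ha 1
  have ha2 := ha 2
  convert h2 using 1
  funext j
  fin_cases j
  · change a 0 * a 1 * a 2 * a 0 = a 0 * a 1 * (a 0 * a 2)
    ring
  · change a 1 = a 0 * a 1 * (a 0)⁻¹
    field_simp
  · change a 2 / (a 0 * a 1 * a 2) = (a 0 * a 1)⁻¹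
    field_simp

/-- The translation `(a₀, a₁, a₂) ↦ (a₀ / q, a₁, q a₂)`. -/
theorem HasRiccatiFamily.translate_inv {b : ℂ} {a : Fin 3 → ℂ} (hb : b ≠ 0) (ha : ∀ j, a j ≠ 0)
    (hq : ∀ n : ℕ, 0 < n → qConst a ^ n ≠ 1) (h : HasRiccatiFamily b a) :
    HasRiccatiFamily b ![a 0 / qConst a, a 1, qConst a * a 2] := by
  have h1 := ((h.rotate 2).reflect hb (fun j => ha _) (by rwa [qConst_rotate])).rotate 2
  have h2 := h1.reflect hb (fun j => reflectParam_ne_zero (fun j => ha _) _)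
    (by rwa [qConst_rotate, qConst_reflectParam (a := fun j => a (j + 2)) (ha _), qConst_rotate])
  have ha0 := ha 0
  have ha1 := ha 1
  have ha2 := ha 2
  convert h2 using 1
  funext j
  fin_cases j
  · change a 0 / (a 0 * a 1 * a 2) = (a 2 * a 1)⁻¹
    field_simp
  · change a 1 = a 2 * a 1 * (a 2)⁻¹
    field_simp
  · change a 0 * a 1 * a 2 * a 2 = a 2 * a 1 * (a 2 * a 0)
    ring

theorem hasRiccatiFamily_zpow {q b : ℂ} (hq0 : q ≠ 0) (hb : b ≠ 0)
    (hq : ∀ n : ℕ, 0 < n → q ^ n ≠ 1) (k : ℤ) :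
    HasRiccatiFamily b ![q ^ k, b, q ^ (1 - k) / b] := by
  have hne : ∀ (k : ℤ) (j : Fin 3), ![q ^ k, b, q ^ (1 - k) / b] j ≠ 0 := by
    intro k j
    fin_cases j
    · exact zpow_ne_zero _ hq0
    · exact hb
    · exact div_ne_zero (zpow_ne_zero _ hq0) hb
  have hconst : ∀ k : ℤ, qConst ![q ^ k, b, q ^ (1 - k) / b] = q := by
    intro k
    change q ^ k * b * (q ^ (1 - k) / b) = q
    rw [zpow_sub₀ hq0, zpow_one]
    have := zpow_ne_zero k hq0
    field_simp
  induction k using Int.induction_on with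
  | zero => exact hasRiccatiFamily_seed (hne 0) (zpow_zero q)
  | succ k ih =>
    have := ih.translate hb (hne _) (by rwa [hconst])
    rw [hconst] at this
    convert this using 2
    · change q ^ ((k : ℤ) + 1) = q * q ^ (k : ℤ)
      rw [zpow_add_one₀ hq0, mul_comm]
    · change ![b, q ^ (1 - ((k : ℤ) + 1)) / b] = ![b, q ^ (1 - (k : ℤ)) / b / q]
      rw [show 1 - ((k : ℤ) + 1) = 1 - k - 1 by ring, zpow_sub_one₀ hq0, div_right_comm,
        div_eq_mul_inv _ q]
  | pred k ih =>
    have := ih.translate_inv hb (hne _) (by rwa [hconst])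
    rw [hconst] at this
    convert this using 2
    · change q ^ (-(k : ℤ) - 1) = q ^ (-(k : ℤ)) / q
      rw [zpow_sub_one₀ hq0, div_eq_mul_inv]
    · change ![b, q ^ (1 - (-(k : ℤ) - 1)) / b] = ![b, q * (q ^ (1 - -(k : ℤ)) / b)]
      rw [show 1 - (-(k : ℤ) - 1) = 1 - -(k : ℤ) + 1 by ring, zpow_add_one₀ hq0, mul_comm _ q,
        mul_div_assoc]

theorem hasRiccatiFamily_of_eq_zpow {a : Fin 3 → ℂ} (ha : ∀ j, a j ≠ 0)
    (hq : ∀ n : ℕ, 0 < n → qConst a ^ n ≠ 1) {i : Fin 3} {k : ℤ} (hik : a i = qConst a ^ k) :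
    HasRiccatiFamily (a (i + 1)) a := by
  have hq0 := qConst_ne_zero ha
  -- The translations act with the integral exponent in slot $0$; rotation by $-i$ puts it in slot
  -- $i$, and $b$ in slot $i+1$.
  have h := (hasRiccatiFamily_zpow hq0 (ha (i + 1)) hq k).rotate (-i)
  have hrot : ![qConst a ^ k, a (i + 1), qConst a ^ (1 - k) / a (i + 1)] =
      fun j => a (j + i) := by
    have hc := qConst_rotate a i
    have h1 := ha (i + 1)
    have hi := ha i
    funext j
    fin_cases j
    · simp [hik]
    · simp [add_comm]
    · change qConst a ^ (1 - k) / a (i + 1) = a (2 + i)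
      simp only [qConst, zero_add] at hc
      rw [zpow_sub₀ hq0, zpow_one, ← hik, qConst, ← hc, add_comm 1 i]
      field_simp
  rw [hrot] at h
  simpa using h

/-! ### Homogenization and the main theorem -/

/-- The polynomial `x ^ (N + 1) * p(c, y / x)` in the variables `c, x, y`. -/
noncomputable def homogenizeRatio (N : ℕ) (p : ℂ[X][X]) : MvPolynomial (Fin 3) ℂ :=
  ∑ k ∈ Finset.range (N + 1), aeval (MvPolynomial.X 0) (p.coeff k) * MvPolynomial.X 2 ^ k *
    MvPolynomial.X 1 ^ (N + 1 - k)

theorem eval_homogenizeRatio (N : ℕ) (p : ℂ[X][X]) (c x y : ℂ) :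
    MvPolynomial.eval ![c, x, y] (homogenizeRatio N p) =
      ∑ k ∈ Finset.range (N + 1), (p.coeff k).eval c * y ^ k * x ^ (N + 1 - k) := by
  rw [homogenizeRatio, map_sum]
  refine Finset.sum_congr rfl fun k _ => ?_
  have : MvPolynomial.eval ![c, x, y] (aeval (MvPolynomial.X 0) (p.coeff k)) =
      (p.coeff k).eval c := by
    induction p.coeff k using Polynomial.induction_on' with
    | add p q hp hq => simp [hp, hq]
    | monomial n r => simp [aeval_monomial, MvPolynomial.algebraMap_eq]
  simp [this]

theorem eval_homogenizeRatio_of_ne_zero {N : ℕ} {p : ℂ[X][X]} (hN : p.natDegree ≤ N) (c y : ℂ)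
    {x : ℂ} (hx : x ≠ 0) : MvPolynomial.eval ![c, x, y] (homogenizeRatio N p) =
      x ^ (N + 1) * p.evalEval c (y / x) := by
  rw [eval_homogenizeRatio, ← map_evalRingHom_eval,
    eval_eq_sum_range' (n := N + 1) (lt_of_le_of_lt natDegree_map_le (by lia)), Finset.mul_sum]
  refine Finset.sum_congr rfl fun k hk => ?_
  rw [coeff_map, coe_evalRingHom, div_pow, pow_sub₀ _ hx (Finset.mem_range.1 hk).le]
  field_simp

/-- The exponent $N+1$ instead of $N$ leaves a spare factor $x$ in every term, so a nonvanishing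
$Q_j$ forces $G_m(c)\ne0$. -/
theorem eval_homogenizeRatio_zero (N : ℕ) (p : ℂ[X][X]) (c y : ℂ) :
    MvPolynomial.eval ![c, 0, y] (homogenizeRatio N p) = 0 := by
  rw [eval_homogenizeRatio]
  refine Finset.sum_eq_zero fun k hk => ?_
  have := Finset.mem_range.1 hk
  rw [zero_pow (by lia), mul_zero]

theorem mainTheorem4 (a : Fin 3 → ℂ) (ha : ∀ j, a j ≠ 0)
    (hq : ∀ n : ℕ, 0 < n → qConst a ^ n ≠ 1)
    (i : Fin 3) (k : ℤ) (hik : a i = qConst a ^ k) :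
    ∃ (m : ℤ) (P Q : Fin 3 → MvPolynomial (Fin 3) ℂ),
      -- every continuous `q`-Hermite–Weber function, on any `q`-stable domain, yields a solution
      (∀ (D : Set ℂ) (G : ℤ → ℂ → ℂ),
        (0 : ℂ) ∉ D → (∀ c ∈ D, qConst a * c ∈ D) →
        IsQHermiteWeber (qConst a) (a (i + 1)) (Set.Ici m) D G →
        (∀ c ∈ D, ∀ j, evalAt (qConst a) (Q j) (G m) c ≠ 0) →
        IsQP4Solution a D (ratExpr (qConst a) P Q (G m))) ∧
      -- these solutions form a family with one effective free parameter
      ∃ C : Set ℂ, C.Countable ∧ ∀ c₀ : ℂ, c₀ ∉ C → c₀ ≠ 0 →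
        ∃ (E : Set ℂ) (G : ℂ → ℤ → ℂ → ℂ), E.Countable ∧
          (∀ t : ℂ, t ∉ E →
            G t m c₀ = 1 ∧ G t m (qConst a * c₀) = t ∧
            IsQHermiteWeber (qConst a) (a (i + 1)) (Set.Ici m) (qOrbit (qConst a) c₀) (G t) ∧
            ((∀ l : ℤ, a (i + 1) ^ 2 ≠ qConst a ^ (2 * l)) →
              IsQHermiteWeber (qConst a) (a (i + 1)) Set.univ (qOrbit (qConst a) c₀) (G t)) ∧
            (∀ c ∈ qOrbit (qConst a) c₀, ∀ j, evalAt (qConst a) (Q j) (G t m) c ≠ 0) ∧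
            IsQP4Solution a (qOrbit (qConst a) c₀) (ratExpr (qConst a) P Q (G t m))) ∧
          (∀ t t' : ℂ, t ∉ E → t' ∉ E → t ≠ t' →
            ∃ j, ratExpr (qConst a) P Q (G t m) j c₀ ≠ ratExpr (qConst a) P Q (G t' m) j c₀) := by
  have hq0 := qConst_ne_zero ha
  have hb := ha (i + 1)
  obtain ⟨p, r, hfam⟩ := hasRiccatiFamily_of_eq_zpow ha hq hik
  -- One bound for all degrees makes the powers of $G_m(c)$ cancel in $P_j/Q_j$.
  let N : ℕ := ∑ j, ((p j).natDegree + (r j).natDegree)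
  have hN : ∀ j, (p j).natDegree + (r j).natDegree ≤ N := fun j =>
    Finset.single_le_sum (f := fun j => (p j).natDegree + (r j).natDegree)
      (fun _ _ => Nat.zero_le _) (Finset.mem_univ j)
  have hNp : ∀ j, (p j).natDegree ≤ N := fun j => (Nat.le_add_right _ _).trans (hN j)
  have hNr : ∀ j, (r j).natDegree ≤ N := fun j => (Nat.le_add_left _ _).trans (hN j)
  have hratio : ∀ (g : ℂ → ℂ) (c : ℂ) (j : Fin 3), g c ≠ 0 →
      ratExpr (qConst a) (fun j => homogenizeRatio N (p j)) (fun j => homogenizeRatio N (r j)) g j c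
        = (p j).evalEval c (g (qConst a * c) / g c) / (r j).evalEval c (g (qConst a * c) / g c) := by
    intro g c j hg
    rw [ratExpr, evalAt, evalAt, eval_homogenizeRatio_of_ne_zero (hNp j) _ _ hg,
      eval_homogenizeRatio_of_ne_zero (hNr j) _ _ hg, mul_div_mul_left _ _ (pow_ne_zero _ hg)]
  have hpart : ∀ (D : Set ℂ) (G : ℤ → ℂ → ℂ),
      (0 : ℂ) ∉ D → (∀ c ∈ D, qConst a * c ∈ D) →
      IsQHermiteWeber (qConst a) (a (i + 1)) (Set.Ici 0) D G →
      (∀ c ∈ D, ∀ j, evalAt (qConst a) (homogenizeRatio N (r j)) (G 0) c ≠ 0) →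
      IsQP4Solution a D (ratExpr (qConst a) (fun j => homogenizeRatio N (p j))
        (fun j => homogenizeRatio N (r j)) (G 0)) := by
    intro D G hD0 hD hG hQ
    have hg : ∀ c ∈ D, G 0 c ≠ 0 := by
      intro c hc h0
      apply hQ c hc 0
      rw [evalAt, h0, eval_homogenizeRatio_zero]
    refine (hfam.isSolution D _ hD0 hD (isRiccati_div (g := G 0) hD hg ?_) ?_).congr hD
      fun c hc j => hratio _ _ _ (hg c hc)
    -- Both relations at $\nu=0$ express $G_1(qc)$: the first at $c$, the second at $qc$.
    · intro c hc
      have h1 := (hG 0 (Set.mem_Ici.2 le_rfl) c hc).1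
      have h2 := (hG 0 (Set.mem_Ici.2 le_rfl) _ (hD c hc)).2
      rw [mul_zero, zpow_zero, mul_one] at h1
      linear_combination h1 - h2
    · intro c hc j
      have := hQ c hc j
      rw [evalAt, eval_homogenizeRatio_of_ne_zero (hNr j) _ _ (hg c hc)] at this
      exact right_ne_zero_of_mul this
  -- The index $m=0$ works for every $k$, because the translations do not change $b$.
  refine ⟨0, fun j => homogenizeRatio N (p j), fun j => homogenizeRatio N (r j), hpart, ?_⟩
  obtain ⟨C, hC, hgen⟩ := exists_countable_generic (W := ∏ j, r j) hq0 hb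
    (Finset.prod_ne_zero_iff.2 fun j _ => hfam.ne_zero j)
  refine ⟨C, hC, fun c₀ hc₀ hc₀0 => ?_⟩
  choose u hu using fun t => exists_isOrbitSeq hq0 hb hc₀0 t
  choose v hv0 hv using fun t => exists_contiguous_seq hq0 hc₀0 (hu t).2.2
  obtain ⟨E, hE, hE'⟩ := hgen c₀ hc₀ hc₀0 u hu
  have happ := orbitFun_apply hq0 hq hc₀0
  have happ' := orbitFun_apply_mul hq0 hq hc₀0
  have hG0 : ∀ t, orbitFun (qConst a) c₀ (v t 0) c₀ = 1 := by
    intro t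
    have := happ (v t 0) 0
    rwa [zpow_zero, one_mul, hv0, (hu t).1, ← hv0] at this
  have hG1 : ∀ t, orbitFun (qConst a) c₀ (v t 0) (qConst a * c₀) = t := by
    intro t
    have := happ' (v t 0) 0
    rwa [zpow_zero, one_mul, hv0, zero_add, (hu t).2.1, ← hv0] at this
  have hcont : ∀ t (V : Set ℤ), (∀ ν ∈ V, 0 ≤ ν ∨ ∀ l : ℤ, a (i + 1) ^ 2 ≠ qConst a ^ (2 * l)) →
      IsQHermiteWeber (qConst a) (a (i + 1)) V (qOrbit (qConst a) c₀)
        (fun ν => orbitFun (qConst a) c₀ (v t ν)) := by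
    rintro t V hV ν hν _ ⟨n, rfl⟩
    simp only [happ, happ']
    exact hv t ν (hV ν hν) n
  have hr : ∀ t, t ∉ E → ∀ n : ℤ, ∀ j, (r j).evalEval (qConst a ^ n * c₀)
      (u t (n + 1) / u t n) ≠ 0 := by
    intro t ht n j
    have := (hE' t ht n).2
    rw [evalEval_prod, Finset.prod_ne_zero_iff] at this
    exact this j (Finset.mem_univ j)
  refine ⟨E, fun t ν => orbitFun (qConst a) c₀ (v t ν), hE, fun t ht => ?_, ?_⟩
  · have hIci := hcont t (Set.Ici 0) fun ν hν => Or.inl hν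
    have hQ : ∀ c ∈ qOrbit (qConst a) c₀, ∀ j, evalAt (qConst a) (homogenizeRatio N (r j))
        (orbitFun (qConst a) c₀ (v t 0)) c ≠ 0 := by
      rintro _ ⟨n, rfl⟩ j
      rw [evalAt, happ, happ', hv0,
        eval_homogenizeRatio_of_ne_zero (hNr j) _ _ (hE' t ht n).1]
      exact mul_ne_zero (pow_ne_zero _ (hE' t ht n).1) (hr t ht n j)
    exact ⟨hG0 t, hG1 t, hIci, fun hl => hcont t _ fun ν _ => Or.inr hl, hQ,
      hpart _ (fun ν => orbitFun (qConst a) c₀ (v t ν)) (zero_notMem_qOrbit hq0 hc₀0)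
        (fun c hc => mul_mem_qOrbit hq0 hc) hIci hQ⟩
  · intro t t' ht ht' hne
    by_contra! hall
    apply hne
    have hr0 : ∀ t, t ∉ E → ∀ j, (r j).evalEval c₀ t ≠ 0 := by
      intro t ht j
      have := hr t ht 0 j
      rwa [zpow_zero, one_mul, zero_add, (hu t).1, (hu t).2.1, div_one] at this
    refine hfam.injective c₀ t t' hc₀0 (hr0 t ht) (hr0 t' ht') fun j => ?_
    have := hall j
    rwa [hratio _ _ _ (by rw [hG0]; exact one_ne_zero),
      hratio _ _ _ (by rw [hG0]; exact one_ne_zero), hG0, hG1, hG0, hG1, div_one, div_one] at this
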